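/- A family of compact Lie groups is a non-empty class of compact Lie groups that is closed under isomorphisms and closed subgroups. For a family $\mathcal F$, a global $\mathcal F$-transfer system $T$ is a partial order $\leqslant_T$ on $\mathcal F$ such that (i) if $K \leqslant_T H$ then $K$ is a closed subgroup of $H$ of finite index; and (ii) for all $G, H, K \in \mathcal F$ and every continuous homomorphism $\theta \colon G \to H$, if $K \leqslant_T H$ then $\theta^{-1}(K) \leqslant_T G$. The global $\mathcal F$-transfer systems form a partially ordered set $I_{\mathcal F}$ with respect to inclusion of relations. Let $\mathrm{AbLie}$ be the family of abelian compact Lie groups and $\mathrm{Ab}$ the family of finite abelian groups (with the discrete topology). Let $U \colon I_{\mathrm{AbLie}} \to I_{\mathrm{Ab}}$ be the order preserving map that restricts the relation of a transfer system to finite abelian groups. Let $R \colon I_{\mathrm{Ab}} \to I_{\mathrm{AbLie}}$ be the order preserving map defined by: $K \leqslant_{R(T)} H$ if and only if $K, H \in \mathrm{AbLie}$, $K$ is a closed subgroup of $H$ of finite index, and $\theta^{-1}(K) \leqslant_T G$ for every finite abelian group $G$ and every continuous homomorphism $\theta \colon G \to H$. **Proposition.** The maps $U$ and $R$ are mutually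 inverse isomorphisms between the partially ordered sets $I_{\mathrm{AbLie}}$ and $I_{\mathrm{Ab}}$. In particular, every global transfer system of abelian compact Lie groups is determined by its restriction to finite abelian groups. -/

import Mathlib

universe u

open scoped Manifold ContDiff
open TopologicalSpace

/-- A topological group is a compact Lie group if it is compact, Hausdorff, and carries the
structure of a finite-dimensional smooth real manifold (without boundary, compatible with its
topology) for which multiplication and inversion are smooth. -/
def IsCompactLieGroup (G : Type u) [Group G] [TopologicalSpace G] : Prop :=
  CompactSpace G ∧ T2Space G ∧
    ∃ (n : ℕ) (_ : ChartedSpace (EuclideanSpace ℝ (Fin n)) G), LieGroup (𝓡 n) ∞ G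

theorem IsCompactLieGroup.isTopologicalGroup {G : Type u} [Group G] [TopologicalSpace G]
    (h : IsCompactLieGroup G) : IsTopologicalGroup G := by
  obtain ⟨-, -, n, _, _⟩ := h
  exact topologicalGroup_of_lieGroup (𝓡 n) ∞

/-- A finite group with the discrete topology is a (zero-dimensional) compact Lie group. -/
theorem IsCompactLieGroup.of_finite {G : Type u} [Group G] [TopologicalSpace G]
    [Finite G] [DiscreteTopology G] : IsCompactLieGroup G := by
  refine ⟨inferInstance, inferInstance, 0,
    ChartedSpace.ofDiscreteTopology (H := EuclideanSpace ℝ (Fin 0)), ?_⟩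
  let : ChartedSpace (EuclideanSpace ℝ (Fin 0)) G := ChartedSpace.ofDiscreteTopology
  have : IsManifold (𝓡 0) ∞ G := IsManifold.of_discreteTopology (E := EuclideanSpace ℝ (Fin 0)) ∞
  have : DiscreteTopology (G × G) := inferInstance
  exact
    { contMDiff_mul := contMDiff_of_discreteTopology
      contMDiff_inv := contMDiff_of_discreteTopology }

/-- Closed subgroups of finite index of a compact Lie group are compact Lie groups. -/
theorem IsCompactLieGroup.subgroup {H : Type u} [Group H] [TopologicalSpace H]
    (h : IsCompactLieGroup H) (K : Subgroup H) (hK : IsClosed (K : Set H)) (hf : K.FiniteIndex) :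
    IsCompactLieGroup K := by
  have := h.isTopologicalGroup
  obtain ⟨_, _, n, _, _⟩ := h
  have ho : IsOpen (K : Set H) := K.isOpen_of_isClosed_of_finiteIndex hK
  let U : Opens H := ⟨K, ho⟩
  have : CompactSpace K := isCompact_iff_compactSpace.mp hK.isCompact
  refine ⟨inferInstance, inferInstance, n,
    (inferInstance : ChartedSpace (EuclideanSpace ℝ (Fin n)) U), ?_⟩
  let : Group U := inferInstanceAs (Group K)
  change LieGroup (𝓡 n) ∞ U
  have hv : ContMDiff (𝓡 n) (𝓡 n) ∞ (Subtype.val : U → H) := contMDiff_subtype_val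
  exact
    { contMDiff_mul := (ContMDiff.subtypeVal_comp_iff U _).1
        ((hv.comp contMDiff_fst).mul (hv.comp contMDiff_snd))
      contMDiff_inv := (ContMDiff.subtypeVal_comp_iff U _).1 hv.inv }

/-- A topological group isomorphic to a compact Lie group is a compact Lie group. -/
theorem IsCompactLieGroup.of_equiv {G H : Type u} [Group G] [TopologicalSpace G]
    [Group H] [TopologicalSpace H] (h : IsCompactLieGroup G) (e : G ≃ₜ* H) :
    IsCompactLieGroup H := by
  obtain ⟨_, _, n, _, _⟩ := h
  let f : H ≃ₜ G := e.symm.toHomeomorph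
  have : CompactSpace H := f.symm.compactSpace
  have : T2Space H := f.symm.t2Space
  let : ChartedSpace (EuclideanSpace ℝ (Fin n)) H :=
    { atlas := Set.range fun q : H =>
        f.toOpenPartialHomeomorph.trans (chartAt (EuclideanSpace ℝ (Fin n)) (f q))
      chartAt := fun q => f.toOpenPartialHomeomorph.trans (chartAt _ (f q))
      mem_chart_source := fun q => by simp
      chart_mem_atlas := fun q => ⟨q, rfl⟩ }
  refine ⟨inferInstance, inferInstance, n, inferInstance, ?_⟩
  have : IsManifold (𝓡 n) ∞ H := by
    refine { compatible := ?_ }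
    rintro _ _ ⟨p, rfl⟩ ⟨q, rfl⟩
    have := (contDiffGroupoid ∞ (𝓡 n)).compatible
      (chart_mem_atlas (EuclideanSpace ℝ (Fin n)) (f p))
      (chart_mem_atlas (EuclideanSpace ℝ (Fin n)) (f q))
    refine (contDiffGroupoid ∞ (𝓡 n)).mem_of_eqOnSource this ⟨?_, ?_⟩
    · ext x; simp
    · intro x hx; simp
  have hf : ContMDiff (𝓡 n) (𝓡 n) ∞ f := by
    intro x
    have hc := contMDiffAt_extChartAt (I := 𝓡 n) (n := ∞) (x := x)
    rw [contMDiffAt_iff_target]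
    exact ⟨f.continuous.continuousAt, hc⟩
  have hs : ContMDiff (𝓡 n) (𝓡 n) ∞ f.symm := by
    intro x
    rw [contMDiffAt_iff_target]
    refine ⟨f.symm.continuous.continuousAt, ?_⟩
    have hc := contMDiffAt_extChartAt (I := 𝓡 n) (n := ∞) (x := x)
    refine hc.congr_of_eventuallyEq (Filter.Eventually.of_forall fun y => ?_)
    change chartAt (EuclideanSpace ℝ (Fin n)) (f (f.symm x)) (f (f.symm y)) = _
    rw [f.apply_symm_apply, f.apply_symm_apply]
    rfl
  have hfe : ∀ x, f x = e.symm x := fun _ => rfl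
  have hse : ∀ x, f.symm x = e x := fun _ => rfl
  refine { contMDiff_mul := ?_, contMDiff_inv := ?_ }
  · refine (hs.comp ((hf.comp contMDiff_fst).mul (hf.comp contMDiff_snd))).congr fun p => ?_
    simp [hfe, hse]
  · refine (hs.comp hf.inv).congr fun p => ?_
    simp [hfe, hse]

/-- A class of compact Lie groups to which the notion of a global transfer system applies: it is
non-empty and closed under isomorphisms and under closed subgroups of finite index. Of the closed
subgroups only those of finite index occur in a transfer system; in particular every class
that is closed under isomorphisms and all closed subgroups is covered. -/
structure LieFamily where
  mem : ∀ (G : Type u) [Group G] [TopologicalSpace G], Prop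
  isCompactLieGroup : ∀ (G : Type u) [Group G] [TopologicalSpace G],
    mem G → IsCompactLieGroup G
  exists_mem : ∃ (G : Type u) (_ : Group G) (_ : TopologicalSpace G), mem G
  of_equiv : ∀ (G H : Type u) [Group G] [TopologicalSpace G] [Group H] [TopologicalSpace H],
    mem G → (G ≃ₜ* H) → mem H
  subgroup : ∀ (H : Type u) [Group H] [TopologicalSpace H] (K : Subgroup H),
    mem H → IsClosed (K : Set H) → K.FiniteIndex → mem K

/-- The family of all abelian compact Lie groups. -/
def LieFamily.abLie : LieFamily.{u} where
  mem G _ _ := IsCompactLieGroup G ∧ ∀ a b : G, a * b = b * a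
  isCompactLieGroup _ _ _ h := h.1
  exists_mem := ⟨PUnit, inferInstance, inferInstance, .of_finite, fun _ _ => rfl⟩
  of_equiv G H _ _ _ _ h e := ⟨h.1.of_equiv e, fun a b => e.symm.injective <| by
    rw [map_mul, map_mul, h.2]⟩
  subgroup H _ _ K h hc hf := ⟨h.1.subgroup K hc hf, fun a b => Subtype.ext (h.2 a b)⟩

/-- The family of all finite abelian groups, with the discrete topology. -/
def LieFamily.ab : LieFamily.{u} where
  mem G _ _ := Finite G ∧ DiscreteTopology G ∧ ∀ a b : G, a * b = b * a
  isCompactLieGroup G _ _ h := by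
    obtain ⟨_, _, -⟩ := h
    exact .of_finite
  exists_mem := ⟨PUnit, inferInstance, inferInstance, inferInstance, inferInstance,
    fun _ _ => rfl⟩
  of_equiv G H _ _ _ _ h e := by
    obtain ⟨_, _, hab⟩ := h
    exact ⟨Finite.of_equiv G e.toEquiv, e.toHomeomorph.symm.isEmbedding.discreteTopology,
      fun a b => e.symm.injective <| by rw [map_mul, map_mul, hab]⟩
  subgroup H _ _ K h _ _ := by
    obtain ⟨_, _, hab⟩ := h
    exact ⟨inferInstance, inferInstance, fun a b => Subtype.ext (hab a b)⟩

theorem LieFamily.ab_le_abLie (G : Type u) [Group G] [TopologicalSpace G]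
    (h : LieFamily.ab.mem G) : LieFamily.abLie.mem G :=
  ⟨LieFamily.ab.isCompactLieGroup G h, h.2.2⟩

/-- A global transfer system for the family `F`: a binary relation on `F`, where `rel H K` stands
for `K ≤ H` in the relation. As the relation only holds between a group `H` and (closed, finite
index) subgroups `K` of `H`, it is encoded as a predicate on pairs of a group and a subgroup of it.
Antisymmetry is then automatic, since two groups each of which is a subgroup of the other are
equal. -/
@[ext]
structure TransferSystem (F : LieFamily.{u}) where
  rel : ∀ (H : Type u) [Group H] [TopologicalSpace H], Subgroup H → Prop
  /-- The relation is a relation on `F` that refines the finite index closed subgroup relation. -/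
  refines : ∀ (H : Type u) [Group H] [TopologicalSpace H] (K : Subgroup H),
    rel H K → F.mem H ∧ F.mem K ∧ IsClosed (K : Set H) ∧ K.FiniteIndex
  reflexive : ∀ (H : Type u) [Group H] [TopologicalSpace H], F.mem H → rel H ⊤
  transitive : ∀ (H : Type u) [Group H] [TopologicalSpace H] (K : Subgroup H) (L : Subgroup K),
    rel H K → rel K L → rel H (L.map K.subtype)
  /-- The relation is closed under pullback along continuous homomorphisms in `F`. -/
  pullback : ∀ (G H : Type u) [Group G] [TopologicalSpace G] [Group H] [TopologicalSpace H]
    (θ : G →* H) (K : Subgroup H), F.mem G → Continuous θ → rel H K → rel G (K.comap θ)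

namespace TransferSystem

variable {E F : LieFamily.{u}}

/-- Transfer systems are ordered by inclusion of relations. -/
instance : PartialOrder (TransferSystem F) where
  le S T := ∀ (H : Type u) [Group H] [TopologicalSpace H] (K : Subgroup H), S.rel H K → T.rel H K
  le_refl _ _ _ _ _ h := h
  le_trans _ _ _ h₁ h₂ H _ _ K h := h₂ H K (h₁ H K h)
  le_antisymm S T h₁ h₂ := by
    ext H _ _ K
    exact ⟨h₁ H K, h₂ H K⟩

/-- The forgetful functor: for families `E ⊆ F`, restrict the relation of an `F`-transfer system
to `E`. -/
def restrict (hEF : ∀ (G : Type u) [Group G] [TopologicalSpace G], E.mem G → F.mem G) :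
    TransferSystem F →o TransferSystem E where
  toFun T :=
    { rel := fun H _ _ K => E.mem H ∧ E.mem K ∧ T.rel H K
      refines := fun H _ _ K h => ⟨h.1, h.2.1, (T.refines H K h.2.2).2.2⟩
      reflexive := fun H _ _ h => by
        have hr := T.reflexive H (hEF H h)
        have hs := T.refines H ⊤ hr
        exact ⟨h, E.subgroup H ⊤ h hs.2.2.1 hs.2.2.2, hr⟩
      transitive := fun H _ _ K L h₁ h₂ => by
        have hr := T.transitive H K L h₁.2.2 h₂.2.2
        have hs := T.refines H _ hr
        exact ⟨h₁.1, E.subgroup H _ h₁.1 hs.2.2.1 hs.2.2.2, hr⟩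
      pullback := fun G H _ _ _ _ θ K hG hθ h => by
        have hr := T.pullback G H θ K (hEF G hG) hθ h.2.2
        have hs := T.refines G _ hr
        exact ⟨hG, E.subgroup G _ hG hs.2.2.1 hs.2.2.2, hr⟩ }
  monotone' _ _ h H _ _ K hK := ⟨hK.1, hK.2.1, h H K hK.2.2⟩

/-- The extension functor: for an `E`-transfer system `T`, the relation `K ≤ H` holds in the
extension of `T` to `F` iff `K, H ∈ F`, `K` is a finite index closed subgroup of `H`, and for each
continuous homomorphism `θ : G → H` with `G ∈ E`, the relation `θ⁻¹(K) ≤ G` holds in `T`. -/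
def extend (E F : LieFamily.{u}) : TransferSystem E →o TransferSystem F where
  toFun T :=
    { rel := fun H _ _ K => F.mem H ∧ F.mem K ∧ IsClosed (K : Set H) ∧ K.FiniteIndex ∧
        ∀ (G : Type u) [Group G] [TopologicalSpace G] (θ : G →* H),
          E.mem G → Continuous θ → T.rel G (K.comap θ)
      refines := fun H _ _ K h => ⟨h.1, h.2.1, h.2.2.1, h.2.2.2.1⟩
      reflexive := fun H _ _ h => by
        refine ⟨h, F.subgroup H ⊤ h isClosed_univ inferInstance, isClosed_univ, inferInstance, ?_⟩
        intro G _ _ θ hG _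
        rw [Subgroup.comap_top]
        exact T.reflexive G hG
      transitive := fun H _ _ K L h₁ h₂ => by
        obtain ⟨hH, hK, hKc, hKf, hKθ⟩ := h₁
        obtain ⟨-, hL, hLc, hLf, hLθ⟩ := h₂
        have hc : IsClosed ((L.map K.subtype : Subgroup H) : Set H) := by
          rw [Subgroup.coe_map]
          exact hKc.isClosedMap_subtype_val _ hLc
        have hf : (L.map K.subtype).FiniteIndex := by
          refine ⟨?_⟩
          rw [Subgroup.index_map_subtype]
          exact mul_ne_zero hLf.index_ne_zero hKf.index_ne_zero
        refine ⟨hH, F.subgroup H _ hH hc hf, hc, hf, ?_⟩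
        intro G _ _ θ hG hθ
        have h1 := hKθ G θ hG hθ
        have h2 := hLθ (K.comap θ) (θ.subgroupComap K) (T.refines G _ h1).2.1
          (Continuous.subtype_mk (hθ.comp continuous_subtype_val) _)
        have h3 := T.transitive G _ _ h1 h2
        convert h3 using 1
        ext x
        simp only [Subgroup.mem_comap, Subgroup.mem_map, Subgroup.coe_subtype, Subtype.exists]
        constructor
        · rintro ⟨y, hy, hyL, hyx⟩
          have hx : θ x ∈ K := hyx ▸ hy
          refine ⟨x, hx, ?_, rfl⟩
          have he : θ.subgroupComap K ⟨x, hx⟩ = ⟨y, hy⟩ := Subtype.ext hyx.symm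
          rw [he]
          exact hyL
        · rintro ⟨y, hy, hyL, rfl⟩
          exact ⟨θ y, hy, hyL, rfl⟩
      pullback := fun G H _ _ _ _ θ K hG hθ h => by
        obtain ⟨hH, hK, hKc, hKf, hKθ⟩ := h
        have hc : IsClosed ((K.comap θ : Subgroup G) : Set G) := hKc.preimage hθ
        have hf : (K.comap θ).FiniteIndex :=
          ⟨by
            rw [Subgroup.index_comap]
            exact (inferInstance : (K.subgroupOf θ.range).FiniteIndex).index_ne_zero⟩
        refine ⟨hG, F.subgroup G _ hG hc hf, hc, hf, ?_⟩
        intro G' _ _ θ' hG' hθ'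
        rw [Subgroup.comap_comap]
        exact hKθ G' (θ.comp θ') hG' (hθ.comp hθ') }
  monotone' _ _ h H _ _ K hK :=
    ⟨hK.1, hK.2.1, hK.2.2.1, hK.2.2.2.1, fun G _ _ θ hG hθ => h G _ (hK.2.2.2.2 G θ hG hθ)⟩

end TransferSystem

/-!
The content is that every transfer system `T` on abelian compact Lie groups is recovered from
its values on finite abelian groups. Let `K` be a closed subgroup of finite index of an abelian
compact Lie group `H`, with identity component `H°`. Two facts reduce `K ≤ H` to a relation
between finite groups.

* `H°` is divisible (`exists_pow_eq_of_mem_connectedComponentOfOne`): the power map `x ↦ x ^ m` has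
  derivative `m • id` at `1` (`hasMFDerivAt_pow_one`), so by the inverse function theorem
  (`HasMFDerivAt.map_nhds_eq`) the `m`-th powers of elements of `H°` form an open subgroup, and it
  contains `H°` by connectedness.
* Divisible abelian groups are injective, so the projection `p : H → π₀ H = H ⧸ H°` onto a finite
  discrete group has a homomorphic section `s` (`exists_section_of_divisible`).

As `K` is clopen, it contains `H°`, hence `K = p⁻¹ (s⁻¹ K)`. If `K ≤ H` holds in the extension of
the restriction of `T`, then `s⁻¹ K ≤ π₀ H` holds in `T` by definition of the extension, and
pulling back along `p` gives `K ≤ H` in `T`. The remaining verifications are formal.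
-/

/-! ### Local surjectivity of power maps on a Lie group -/

/-- A consequence of the inverse function theorem for manifolds without boundary: a `C¹` map with
surjective derivative at `x` maps the neighborhoods of `x` onto the neighborhoods of `f x`. -/
theorem HasMFDerivAt.map_nhds_eq {E E' H H' M M' : Type*}
    [NormedAddCommGroup E] [NormedSpace ℝ E] [CompleteSpace E]
    [NormedAddCommGroup E'] [NormedSpace ℝ E'] [CompleteSpace E']
    [TopologicalSpace H] [TopologicalSpace H']
    {I : ModelWithCorners ℝ E H} {I' : ModelWithCorners ℝ E' H'}
    [I.Boundaryless] [I'.Boundaryless]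
    [TopologicalSpace M] [ChartedSpace H M] [TopologicalSpace M'] [ChartedSpace H' M']
    {f : M → M'} {x : M} {f' : E →L[ℝ] E'}
    (hf : ContMDiffAt I I' 1 f x) (hf' : HasMFDerivAt I I' f x f')
    (hsurj : Function.Surjective f') : Filter.map f (nhds x) = nhds (f x) := by
  set w : E → E' := writtenInExtChartAt I I' x f with hw
  have hd : HasFDerivAt w f' (extChartAt I x x) := by
    have h : HasFDerivWithinAt w f' (Set.range I) (extChartAt I x x) := hf'.2
    rwa [I.range_eq_univ, hasFDerivWithinAt_univ] at h
  have hc : ContDiffAt ℝ 1 w (extChartAt I x x) := by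
    have h := (contMDiffAt_iff.1 hf).2
    rwa [I.range_eq_univ, contDiffWithinAt_univ] at h
  have hwmap : Filter.map w (nhds (extChartAt I x x)) = nhds (extChartAt I' (f x) (f x)) := by
    have h := (hc.hasStrictFDerivAt' hd one_ne_zero).map_nhds_eq_of_surj
      (LinearMap.range_eq_top.2 hsurj)
    rw [h, hw]
    simp [writtenInExtChartAt]
  have hsymm : Filter.map (extChartAt I' (f x)).symm (nhds (extChartAt I' (f x) (f x))) =
      nhds (f x) := by
    have h := map_extChartAt_symm_nhdsWithin_range (I := I') (f x)
    rwa [I'.range_eq_univ, nhdsWithin_univ] at h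
  rw [← hsymm, ← hwmap, ← map_extChartAt_nhds_of_boundaryless (I := I) x, Filter.map_map,
    Filter.map_map]
  refine Filter.map_congr ?_
  filter_upwards [extChartAt_source_mem_nhds (I := I) x,
    hf.continuousAt.preimage_mem_nhds (extChartAt_source_mem_nhds (I := I') (f x))] with y hy hfy
  simp only [Function.comp_apply, hw, writtenInExtChartAt]
  rw [(extChartAt I x).left_inv hy, (extChartAt I' (f x)).left_inv hfy]

section LieGroup

variable {E H G : Type*} [NormedAddCommGroup E] [NormedSpace ℝ E] [TopologicalSpace H]
  {I : ModelWithCorners ℝ E H} [TopologicalSpace G] [ChartedSpace H G] [Group G]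

/-- The derivative of the multiplication of a Lie group at the identity is the addition.
The points are variables so that the lemma applies at expressions only propositionally equal
to `1`. -/
theorem hasMFDerivAt_mul_one [LieGroup I ∞ G] {a b : G} (ha : a = 1) (hb : b = 1) :
    HasMFDerivAt (I.prod I) I (fun p : G × G => p.1 * p.2) (a, b)
      (ContinuousLinearMap.fst ℝ E E + ContinuousLinearMap.snd ℝ E E : E × E →L[ℝ] E) := by
  subst ha hb
  have hm : MDifferentiableAt (I.prod I) I (fun p : G × G => p.1 * p.2) ((1, 1) : G × G) :=
    (contMDiff_mul I ∞).mdifferentiableAt (by simp)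
  have h₁ : HasMFDerivAt I I (fun z : G => z * 1) 1 (ContinuousLinearMap.id ℝ E) :=
    (hasMFDerivAt_id (I := I) (1 : G)).congr_of_eventuallyEq (.of_forall mul_one)
  have h₂ : HasMFDerivAt I I (fun z : G => 1 * z) 1 (ContinuousLinearMap.id ℝ E) :=
    (hasMFDerivAt_id (I := I) (1 : G)).congr_of_eventuallyEq (.of_forall one_mul)
  have he : mfderiv (I.prod I) I (fun p : G × G => p.1 * p.2) ((1, 1) : G × G) =
      (ContinuousLinearMap.fst ℝ E E + ContinuousLinearMap.snd ℝ E E : E × E →L[ℝ] E) := by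
    refine ContinuousLinearMap.ext fun v => (mfderiv_prod_eq_add_apply hm).trans ?_
    exact congrArg₂ (fun a b : E => a + b) (DFunLike.congr_fun h₁.mfderiv v.1)
      (DFunLike.congr_fun h₂.mfderiv v.2)
  exact he ▸ hm.hasMFDerivAt

/-- The `m`-th power map of a Lie group has derivative `m • id` at the identity. -/
theorem hasMFDerivAt_pow_one [LieGroup I ∞ G] (m : ℕ) :
    HasMFDerivAt I I (fun x : G => x ^ m) 1 ((m : ℝ) • ContinuousLinearMap.id ℝ E : E →L[ℝ] E) := by
  induction m with
  | zero =>
    have h : HasMFDerivAt I I (fun x : G => x ^ 0) 1 (0 : E →L[ℝ] E) :=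
      (hasMFDerivAt_const (I := I) (I' := I) (1 : G) (1 : G)).congr_of_eventuallyEq
        (.of_forall pow_zero)
    simpa using h
  | succ m ih =>
    have h : HasMFDerivAt I I (fun x : G => x ^ (m + 1)) 1
        ((ContinuousLinearMap.fst ℝ E E + ContinuousLinearMap.snd ℝ E E).comp
          (((m : ℝ) • ContinuousLinearMap.id ℝ E).prod (ContinuousLinearMap.id ℝ E))) :=
      (HasMFDerivAt.comp (1 : G) (f := fun x : G => (x ^ m, x))
        (hasMFDerivAt_mul_one (I := I) (one_pow (M := G) m) (rfl : (1 : G) = 1))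
        (ih.prodMk (hasMFDerivAt_id (I := I) (1 : G)))).congr_of_eventuallyEq
          (.of_forall fun x => pow_succ x m)
    have he : (ContinuousLinearMap.fst ℝ E E + ContinuousLinearMap.snd ℝ E E).comp
        (((m : ℝ) • ContinuousLinearMap.id ℝ E).prod (ContinuousLinearMap.id ℝ E)) =
        ((m + 1 : ℕ) : ℝ) • ContinuousLinearMap.id ℝ E := by
      ext v
      simp [add_smul]
    exact h.congr_mfderiv he

theorem map_pow_nhds_one [CompleteSpace E] [I.Boundaryless] [LieGroup I ∞ G] {m : ℕ} (hm : m ≠ 0) :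
    Filter.map (fun x : G => x ^ m) (nhds 1) = nhds 1 := by
  have hc : ContMDiffAt I I 1 (fun x : G => x ^ m) 1 :=
    ((contMDiff_pow (I := I) (n := ∞) m).of_le (by simp)).contMDiffAt
  have h := (hasMFDerivAt_pow_one (I := I) (G := G) m).map_nhds_eq hc fun v =>
    ⟨(m : ℝ)⁻¹ • v, by simp [smul_smul, hm]⟩
  simpa using h

end LieGroup

/-! ### The identity component of an abelian compact Lie group -/

theorem IsCompactLieGroup.isOpen_connectedComponentOfOne {H : Type u} [Group H]
    [TopologicalSpace H] [IsTopologicalGroup H] (h : IsCompactLieGroup H) :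
    IsOpen (Subgroup.connectedComponentOfOne H : Set H) := by
  obtain ⟨-, -, n, _, -⟩ := h
  have := ChartedSpace.locallyConnectedSpace (EuclideanSpace ℝ (Fin n)) H
  exact isOpen_connectedComponent

theorem Subgroup.connectedComponentOfOne_le_of_isOpen {H : Type*} [Group H] [TopologicalSpace H]
    [IsTopologicalGroup H] {K : Subgroup H} (hK : IsOpen (K : Set H)) :
    Subgroup.connectedComponentOfOne H ≤ K :=
  IsClopen.connectedComponent_subset ⟨K.isClosed_of_isOpen hK, hK⟩ K.one_mem

/-- The identity component of an abelian compact Lie group is divisible. -/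
theorem IsCompactLieGroup.exists_pow_eq_of_mem_connectedComponentOfOne {H : Type u} [CommGroup H]
    [TopologicalSpace H] [IsTopologicalGroup H] (h : IsCompactLieGroup H) {m : ℕ} (hm : m ≠ 0)
    {x : H} (hx : x ∈ Subgroup.connectedComponentOfOne H) :
    ∃ y ∈ Subgroup.connectedComponentOfOne H, y ^ m = x := by
  have hD := h.isOpen_connectedComponentOfOne
  obtain ⟨-, -, n, _, _⟩ := h
  have hmem : (((Subgroup.connectedComponentOfOne H).map (powMonoidHom m) : Subgroup H) : Set H) ∈
      nhds (1 : H) := by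
    rw [← map_pow_nhds_one (I := 𝓡 n) (G := H) hm]
    exact Filter.image_mem_map (hD.mem_nhds (one_mem _))
  exact Subgroup.connectedComponentOfOne_le_of_isOpen (Subgroup.isOpen_of_mem_nhds _ hmem) hx

/-! ### Splitting off a divisible subgroup -/

/-- A divisible subgroup of an abelian group is a retract, as divisible abelian groups are
injective. -/
theorem Subgroup.exists_retraction_of_divisible {A : Type*} [CommGroup A] (D : Subgroup A)
    (hD : ∀ m : ℕ, m ≠ 0 → ∀ x ∈ D, ∃ y ∈ D, y ^ m = x) :
    ∃ r : A →* D, ∀ x : D, r x = x := by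
  have hroot : ∀ {m : ℕ}, m ≠ 0 → Function.Surjective fun a : Additive D => m • a := by
    intro m hm a
    obtain ⟨y, hy, hyx⟩ := hD m hm a.toMul a.toMul.2
    exact ⟨Additive.ofMul ⟨y, hy⟩, Additive.toMul.injective (Subtype.ext hyx)⟩
  let : DivisibleBy (Additive D) ℕ := divisibleByOfSMulRightSurj _ _ hroot
  let : DivisibleBy (Additive D) ℤ := AddGroup.divisibleByIntOfDivisibleByNat _
  obtain ⟨r, hr⟩ := (Module.Baer.of_divisible (Additive D)).extension_property_addMonoidHom
    (MonoidHom.toAdditive D.subtype) D.subtype_injective (AddMonoidHom.id _)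
  exact ⟨MonoidHom.toAdditive.symm r, fun x => DFunLike.congr_fun hr (Additive.ofMul x)⟩

/-- The quotient of an abelian group by a divisible subgroup has a homomorphic section. -/
theorem Subgroup.exists_section_of_divisible {A : Type*} [CommGroup A] (D : Subgroup A)
    (hD : ∀ m : ℕ, m ≠ 0 → ∀ x ∈ D, ∃ y ∈ D, y ^ m = x) :
    ∃ s : A ⧸ D →* A, ∀ q, (s q : A ⧸ D) = q := by
  obtain ⟨r, hr⟩ := D.exists_retraction_of_divisible hD
  refine ⟨QuotientGroup.lift D (MonoidHom.id A / D.subtype.comp r) fun x hx => ?_, fun q => ?_⟩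
  · have : r x = ⟨x, hx⟩ := hr ⟨x, hx⟩
    simp [this]
  · induction q using QuotientGroup.induction_on with
    | H a =>
      rw [QuotientGroup.lift_mk, QuotientGroup.eq]
      simp

/-- The projection of an abelian compact Lie group onto its finite group of components splits. All
closed subgroups of finite index are pulled back from this finite group. -/
theorem IsCompactLieGroup.exists_finite_comap_comap_eq {H : Type u} [Group H] [TopologicalSpace H]
    (h : IsCompactLieGroup H) (hcomm : ∀ a b : H, a * b = b * a) :
    ∃ (F : Type u) (_ : Group F) (_ : TopologicalSpace F) (p : H →* F) (s : F →* H),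
      LieFamily.ab.mem F ∧ Continuous p ∧ Continuous s ∧
      ∀ K : Subgroup H, IsClosed (K : Set H) → K.FiniteIndex → (K.comap s).comap p = K := by
  let : CommGroup H := { ‹Group H› with mul_comm := hcomm }
  have := h.isTopologicalGroup
  have := h.1
  let D := Subgroup.connectedComponentOfOne H
  have hD : IsOpen (D : Set H) := h.isOpen_connectedComponentOfOne
  obtain ⟨s, hs⟩ := D.exists_section_of_divisible fun m hm x hx =>
    h.exists_pow_eq_of_mem_connectedComponentOfOne hm hx
  have : DiscreteTopology (H ⧸ D) := QuotientGroup.discreteTopology hD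
  refine ⟨H ⧸ D, inferInstance, inferInstance, QuotientGroup.mk' D, s,
    ⟨D.quotient_finite_of_isOpen hD, inferInstance, mul_comm⟩, continuous_quotient_mk',
    continuous_of_discreteTopology, fun K hKc hKf => ?_⟩
  have hDK : D ≤ K := Subgroup.connectedComponentOfOne_le_of_isOpen
    (K.isOpen_of_isClosed_of_finiteIndex hKc)
  ext x
  simp only [Subgroup.mem_comap, QuotientGroup.mk'_apply]
  have hx : (s (x : H ⧸ D))⁻¹ * x ∈ K := hDK (QuotientGroup.eq.1 (hs x))
  exact (K.mul_mem_cancel_right hx).symm.trans (by rw [mul_inv_cancel_left])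

/-! ### Restriction and extension of transfer systems -/

namespace TransferSystem

theorem restrict_extend {E F : LieFamily.{u}}
    (hEF : ∀ (G : Type u) [Group G] [TopologicalSpace G], E.mem G → F.mem G)
    (T : TransferSystem E) : restrict hEF (extend E F T) = T := by
  ext H _ _ K
  constructor
  · rintro ⟨hH, -, -, -, -, -, h⟩
    simpa using h H (MonoidHom.id H) hH continuous_id
  · intro h
    obtain ⟨hH, hK, hc, hf⟩ := T.refines H K h
    exact ⟨hH, hK, hEF H hH, hEF K hK, hc, hf,
      fun G _ _ θ hG hθ => T.pullback G H θ K hG hθ h⟩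

theorem extend_restrict_abLie (T : TransferSystem LieFamily.abLie.{u}) :
    extend LieFamily.ab LieFamily.abLie (restrict LieFamily.ab_le_abLie T) = T := by
  ext H _ _ K
  constructor
  · rintro ⟨hH, -, hc, hf, h⟩
    obtain ⟨F, _, _, p, s, hF, hp, hs, hK⟩ := hH.1.exists_finite_comap_comap_eq hH.2
    have hT := T.pullback H F p (K.comap s) hH hp (h F s hF hs).2.2
    rwa [hK K hc hf] at hT
  · intro h
    obtain ⟨hH, hK, hc, hf⟩ := T.refines H K h
    refine ⟨hH, hK, hc, hf, fun G _ _ θ hG hθ => ?_⟩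
    have hT := T.pullback G H θ K (LieFamily.ab_le_abLie G hG) hθ h
    obtain ⟨-, -, hc', hf'⟩ := T.refines G _ hT
    exact ⟨hG, LieFamily.ab.subgroup G _ hG hc' hf', hT⟩

end TransferSystem

/-- Restriction to finite abelian groups and extension to abelian compact Lie groups are mutually
inverse isomorphisms of partially ordered sets; in particular a transfer system of abelian compact
Lie groups is determined by its restriction to finite abelian groups. -/
theorem proposition7p1 :
    (∃ e : TransferSystem LieFamily.abLie.{u} ≃o TransferSystem LieFamily.ab.{u},
      (∀ T, e T = TransferSystem.restrict LieFamily.ab_le_abLie T) ∧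
      (∀ T, e.symm T = TransferSystem.extend LieFamily.ab LieFamily.abLie T)) ∧
    (∀ S T : TransferSystem LieFamily.abLie.{u},
      (∀ (H : Type u) [Group H] [TopologicalSpace H] (K : Subgroup H),
        LieFamily.ab.mem H → (S.rel H K ↔ T.rel H K)) → S = T) := by
  refine ⟨⟨{ toFun := TransferSystem.restrict LieFamily.ab_le_abLie
             invFun := TransferSystem.extend LieFamily.ab LieFamily.abLie
             left_inv := TransferSystem.extend_restrict_abLie
             right_inv := TransferSystem.restrict_extend LieFamily.ab_le_abLie
             map_rel_iff' := ?_ }, fun _ => rfl, fun _ => rfl⟩, ?_⟩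
  · intro S T
    refine ⟨fun h => ?_, fun h => (TransferSystem.restrict LieFamily.ab_le_abLie).monotone h⟩
    rw [← TransferSystem.extend_restrict_abLie S, ← TransferSystem.extend_restrict_abLie T]
    exact (TransferSystem.extend LieFamily.ab LieFamily.abLie).monotone h
  · intro S T h
    rw [← TransferSystem.extend_restrict_abLie S, ← TransferSystem.extend_restrict_abLie T]
    congr 1
    ext H _ _ K
    exact ⟨fun hS => ⟨hS.1, hS.2.1, (h H K hS.1).1 hS.2.2⟩,
      fun hT => ⟨hT.1, hT.2.1, (h H K hT.1).2 hT.2.2⟩⟩
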